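/- Let $\mathbf A=\langle A;f\rangle$ be a finite (non-empty) monounary algebra, i.e. a finite non-empty set $A$ with one unary operation $f\colon A\to A$. A cycle of $\mathbf A$ is a non-empty subset $\{a_0,\dots,a_{m-1}\}$ of $A$, with the $a_i$ pairwise distinct, such that $f(a_i)=a_{i+1 \,(\mathrm{mod}\ m)}$ for all $i$. Let $n$ be the least common multiple of the sizes of the cycles of $\mathbf A$. Let $\mathrm{Var}(\mathbf A)$ be the variety generated by $\mathbf A$ (all algebras satisfying every equation true in $\mathbf A$), and let $\mathrm{Var}(\mathbf A)_{\mathrm{fin}}$ be the class of its finite non-empty members. Write $\mathbf B\to\mathbf C$ if there is a homomorphism from $\mathbf B$ to $\mathbf C$, and $\mathbf B\equiv\mathbf C$ if $\mathbf B\to\mathbf C$ and $\mathbf C\to\mathbf B$. The homomorphism lattice induced by $\mathbf A$ is the ordered set $\mathbf L_{\mathbf A}=\langle \mathrm{Var}(\mathbf A)_{\mathrm{fin}}/{\equiv};\to\rangle$. For $k\ge 1$ let $\mathbf k$ be the $k$-element chain. If $n=1$, then $\mathbf L_{\mathbf A}\cong\mathbf 1$. Otherwise, let $n=p_1^{k_1}\cdots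 p_\ell^{k_\ell}$ be the prime decomposition of $n$ (distinct primes $p_i$, all $k_i\ge 1$). Then \[ \mathbf L_{\mathbf A}\;\cong\;(\mathbf k_1\sqcup\dots\sqcup\mathbf k_\ell)\oplus\mathbf 1, \] where the coproduct $\sqcup$ exists and is taken in the category of (not necessarily bounded) distributive lattices with lattice homomorphisms, and $\oplus\,\mathbf 1$ denotes adding a new top element. -/

import Mathlib

universe u v w

open FirstOrder FirstOrder.Language CategoryTheory.Limits

namespace HomOrder

section General

variable (L : FirstOrder.Language.{v, w}) (A : Type u) [L.Structure A]

/-- `B` belongs to the variety (equational class) generated by `A`: every equation `s ≈ t`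
between terms of the signature `L` that is true in `A` is true in `B`.
(The signature is meant to have no relation symbols.) -/
def MemVar (B : Type u) [L.Structure B] : Prop :=
  ∀ s t : L.Term ℕ,
    (∀ x : ℕ → A, s.realize x = t.realize x) → ∀ x : ℕ → B, s.realize x = t.realize x

/-- The finite members of the variety generated by `A`; algebras are non-empty. -/
structure VarFin where
  carrier : Type u
  [str : L.Structure carrier]
  [finite : Finite carrier]
  [nonempty : Nonempty carrier]
  mem : MemVar L A carrier

attribute [instance] VarFin.str VarFin.finite VarFin.nonempty

/-- The homomorphism quasi-order: `B ≤ C` iff there is a homomorphism from `B` to `C`. -/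
instance : Preorder (VarFin L A) where
  le B C := Nonempty (B.carrier →[L] C.carrier)
  le_refl B := ⟨Hom.id L B.carrier⟩
  le_trans _ _ _ := fun ⟨g⟩ ⟨h⟩ => ⟨h.comp g⟩

/-- The homomorphism lattice induced by `A`: the finite members of the variety generated by `A`
modulo homomorphic equivalence (`B → C` and `C → B`), ordered by the existence of a
homomorphism. -/
abbrev HomLattice : Type (max (u + 1) v w) :=
  Antisymmetrization (VarFin L A) (· ≤ ·)

end General

/-- The function symbols of monounary algebras: a single unary symbol. -/
inductive MonounaryFunc : ℕ → Type
  | op : MonounaryFunc 1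

/-- The signature of monounary algebras. -/
def monounary : FirstOrder.Language.{0, 0} where
  Functions := MonounaryFunc
  Relations := fun _ => Empty

section Cycles

variable (A : Type u) [monounary.Structure A]

/-- The fundamental operation of a monounary algebra. -/
def op (a : A) : A :=
  Structure.funMap (L := monounary) MonounaryFunc.op ![a]

/-- `C = {a₀, …, aₘ₋₁}` with `m ≥ 1`, the `aᵢ` pairwise distinct, and `f aᵢ = aᵢ₊₁`, the indices
taken modulo `m`. -/
def IsCycle (C : Finset A) : Prop :=
  ∃ (m : ℕ) (_ : NeZero m) (a : Fin m → A),
    Function.Injective a ∧ Set.range a = (C : Set A) ∧ ∀ i, op A (a i) = a (i + 1)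

open Classical in
/-- The least common multiple of the sizes of the cycles of a finite monounary algebra. -/
noncomputable def cycleLcm [Fintype A] : ℕ :=
  (Finset.univ.filter fun C : Finset A => IsCycle A C).lcm Finset.card

end Cycles

/-- For `n = p₁^k₁ ⋯ pₗ^kₗ`, the family of the `kᵢ`-element chains, in the category of (not
necessarily bounded) distributive lattices and lattice homomorphisms; it is indexed by the primes
dividing `n`. -/
noncomputable def chains (n : ℕ) (p : n.primeFactors) : DistLat.{0} :=
  DistLat.of (Fin (n.factorization p))

end HomOrder

/-! Write `n` for the lcm of the cycle sizes. In a member of the variety, `|A|` steps of the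
operation carry every element to a point whose period divides `n`. A homomorphism `B → C` therefore
exists exactly when, for every `d ∣ n`, a point of `B` fixed by the `d`-th iterate forces one in `C`
(`exists_semiconj_iff`). So `B` is determined up to equivalence by its set of periods dividing `n`,
which contains `n` and is closed under multiples dividing `n`. If `n = 1`, there is only one such
set. If `n ≠ 1`, disjoint unions of cycles realise every such set (`exists_periodSet_eq`).

Reversing divisibility turns the divisors into the grid `∏ (kᵢ + 1)` and these sets into the lower
sets containing `⊥`. The whole grid, where a fixed point exists, is the new top. The remaining lower
sets omit `⊤` and form the coproduct of the chains: they are generated by the sets `{e | e i ≤ j}`,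
and chain maps `gᵢ` extend by `U ↦ ⋁_{e ∈ U} ⋀ᵢ gᵢ(eᵢ)`, computed with a bottom and a top adjoined
to the target. -/

namespace HomOrder

/-! ### Coproducts of finite chains as lattices of lower sets. -/

section Coproduct

/-- The lower sets of a bounded lattice that are neither empty nor everything. -/
def properLowerSets (α : Type*) [Lattice α] [BoundedOrder α] : Sublattice (LowerSet α) where
  carrier := {U | ⊥ ∈ U ∧ ⊤ ∉ U}
  supClosed' := by
    rintro U ⟨hU, hU'⟩ V ⟨hV, hV'⟩
    exact ⟨Or.inl hU, fun h => h.elim hU' hV'⟩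
  infClosed' := by
    rintro U ⟨hU, hU'⟩ V ⟨hV, hV'⟩
    exact ⟨⟨hU, hV⟩, fun h => hU' h.1⟩

variable {ι : Type*} (k : ι → ℕ)

/-- The product of the chains with one more element than prescribed. -/
abbrev Grid := ∀ i, Fin (k i + 1)

/-- The `i`-th chain sits in the proper lower sets of the grid as the sets `{e | e i ≤ j}`. -/
def chainHom (i : ι) : LatticeHom (Fin (k i)) (properLowerSets (Grid k)) where
  toFun j := ⟨⟨{e | e i ≤ j.castSucc}, fun _ _ h h' => (h i).trans h'⟩,
    Fin.zero_le _, fun h => (Fin.castSucc_lt_last j).not_ge h⟩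
  map_sup' a b := by
    refine Subtype.ext (LowerSet.ext (Set.ext fun e => ?_))
    change e i ≤ (a ⊔ b).castSucc ↔ e i ≤ a.castSucc ∨ e i ≤ b.castSucc
    rw [Fin.strictMono_castSucc.monotone.map_sup, le_sup_iff]
  map_inf' a b := by
    refine Subtype.ext (LowerSet.ext (Set.ext fun e => ?_))
    change e i ≤ (a ⊓ b).castSucc ↔ e i ≤ a.castSucc ∧ e i ≤ b.castSucc
    rw [Fin.strictMono_castSucc.monotone.map_inf, le_inf_iff]

theorem mem_chainHom {i : ι} {j : Fin (k i)} {e : Grid k} :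
    e ∈ (chainHom k i j : LowerSet (Grid k)) ↔ e i ≤ j.castSucc := Iff.rfl

variable {Y : Type*}

/-- The inclusion of a lattice into its extension by a new bottom and a new top. -/
def bddCoe (y : Y) : WithBot (WithTop Y) := ((y : WithTop Y) : WithBot (WithTop Y))

theorem bddCoe_injective : Function.Injective (bddCoe (Y := Y)) := fun _ _ h =>
  WithTop.coe_injective (WithBot.coe_injective h)

theorem bddCoe_ne_top (y : Y) : bddCoe y ≠ ⊤ := fun h =>
  WithTop.coe_ne_top (WithBot.coe_injective h)

theorem exists_bddCoe {x : WithBot (WithTop Y)} (h : x ≠ ⊥) (h' : x ≠ ⊤) :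
    ∃ y, bddCoe y = x := by
  obtain ⟨z, rfl⟩ := WithBot.ne_bot_iff_exists.1 h
  obtain ⟨y, rfl⟩ := WithTop.ne_top_iff_exists.1 (fun hz : z = ⊤ => h' (by rw [hz]; rfl))
  exact ⟨y, rfl⟩

/-- The extension of a map on a chain by sending a new top to the new top. -/
def extendTop {m : ℕ} (g : Fin m → Y) (a : Fin (m + 1)) : WithBot (WithTop Y) :=
  if h : (a : ℕ) < m then bddCoe (g ⟨a, h⟩) else ⊤

theorem extendTop_castSucc {m : ℕ} (g : Fin m → Y) (a : Fin m) :
    extendTop g a.castSucc = bddCoe (g a) := by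
  simp [extendTop]

theorem extendTop_last {m : ℕ} (g : Fin m → Y) : extendTop g ⊤ = ⊤ := by
  simp [extendTop, Fin.top_eq_last]

theorem extendTop_ne_bot {m : ℕ} (g : Fin m → Y) (a : Fin (m + 1)) : extendTop g a ≠ ⊥ := by
  unfold extendTop
  split_ifs
  · exact WithBot.coe_ne_bot
  · exact WithBot.coe_ne_bot

variable [DistribLattice Y]

theorem bddCoe_sup (a b : Y) : bddCoe (a ⊔ b) = bddCoe a ⊔ bddCoe b := rfl

theorem bddCoe_inf (a b : Y) : bddCoe (a ⊓ b) = bddCoe a ⊓ bddCoe b := rfl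

theorem bddCoe_mono : Monotone (bddCoe (Y := Y)) := fun _ _ h =>
  WithBot.coe_le_coe.2 (WithTop.coe_le_coe.2 h)

/-- Adjoined bounds are not finite meets or joins of other elements; this keeps the extended
homomorphism inside `Y`. -/
theorem inf_ne_bot_of_ne_bot {x y : WithBot (WithTop Y)} (hx : x ≠ ⊥) (hy : y ≠ ⊥) :
    x ⊓ y ≠ ⊥ := by
  obtain ⟨a, rfl⟩ := WithBot.ne_bot_iff_exists.1 hx
  obtain ⟨b, rfl⟩ := WithBot.ne_bot_iff_exists.1 hy
  rw [← WithBot.coe_inf]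
  exact WithBot.coe_ne_bot

theorem sup_ne_top_of_ne_top {x y : WithBot (WithTop Y)} (hx : x ≠ ⊤) (hy : y ≠ ⊤) :
    x ⊔ y ≠ ⊤ := by
  by_cases hx' : x = ⊥
  · rwa [hx', bot_sup_eq]
  by_cases hy' : y = ⊥
  · rwa [hy', sup_bot_eq]
  obtain ⟨a, rfl⟩ := exists_bddCoe hx' hx
  obtain ⟨b, rfl⟩ := exists_bddCoe hy' hy
  exact bddCoe_ne_top (a ⊔ b)

theorem extendTop_mono {m : ℕ} {g : Fin m → Y} (hg : Monotone g) : Monotone (extendTop g) := by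
  intro a b hab
  by_cases hb : (b : ℕ) < m
  · have ha : (a : ℕ) < m := lt_of_le_of_lt hab hb
    rw [extendTop, extendTop, dif_pos ha, dif_pos hb]
    exact bddCoe_mono (hg hab)
  · rw [extendTop, extendTop, dif_neg hb]
    exact le_top

variable {k} [Fintype ι] (g : ∀ i, LatticeHom (Fin (k i)) Y)

/-- The value on the principal lower set of `e` of the homomorphism induced by `g`. -/
def gridInf (e : Grid k) : WithBot (WithTop Y) :=
  Finset.univ.inf fun i => extendTop (g i) (e i)

theorem gridInf_inf (e e' : Grid k) : gridInf g (e ⊓ e') = gridInf g e ⊓ gridInf g e' := by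
  rw [gridInf, gridInf, gridInf, ← Finset.inf_inf]
  exact Finset.inf_congr rfl fun i _ =>
    (extendTop_mono (OrderHomClass.mono (g i))).map_inf (e i) (e' i)

theorem gridInf_ne_bot (e : Grid k) : gridInf g e ≠ ⊥ :=
  Finset.inf_induction (p := fun x => x ≠ ⊥) WithBot.coe_ne_bot
    (fun _ h _ h' => inf_ne_bot_of_ne_bot h h') fun _ _ => extendTop_ne_bot _ _

theorem gridInf_ne_top {e : Grid k} (he : e ≠ ⊤) : gridInf g e ≠ ⊤ := by
  obtain ⟨i, hi⟩ := Function.ne_iff.1 he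
  obtain ⟨j, hj⟩ := Fin.exists_castSucc_eq.2 (show e i ≠ Fin.last _ from hi)
  have h : gridInf g e ≤ extendTop (g i) (e i) := Finset.inf_le (Finset.mem_univ i)
  rw [← hj, extendTop_castSucc] at h
  intro h'
  rw [h', top_le_iff] at h
  exact bddCoe_ne_top _ h

open Classical in
/-- The homomorphism induced by `g`, with values in the bounded extension of `Y`. -/
noncomputable def gridSup (U : LowerSet (Grid k)) : WithBot (WithTop Y) :=
  (Finset.univ.filter (· ∈ U)).sup (gridInf g)

theorem gridSup_sup (U V : LowerSet (Grid k)) : gridSup g (U ⊔ V) = gridSup g U ⊔ gridSup g V := by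
  classical
  rw [gridSup, gridSup, gridSup, ← Finset.sup_union]
  refine congrArg (Finset.sup · _) (Finset.ext fun e => ?_)
  simp only [Finset.mem_filter, Finset.mem_union, Finset.mem_univ, true_and]
  rfl

theorem gridInf_le_gridSup {U : LowerSet (Grid k)} {e : Grid k} (h : e ∈ U) :
    gridInf g e ≤ gridSup g U := by
  classical
  exact Finset.le_sup (f := gridInf g) (Finset.mem_filter.2 ⟨Finset.mem_univ _, h⟩)

/-- Distributivity reduces the meet of joins to pairs `(e, e')`, and `e ⊓ e'` lies in both lower
sets. -/
theorem gridSup_inf (U V : LowerSet (Grid k)) : gridSup g (U ⊓ V) = gridSup g U ⊓ gridSup g V := by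
  classical
  apply le_antisymm
  · refine le_inf (Finset.sup_mono ?_) (Finset.sup_mono ?_)
    · exact Finset.monotone_filter_right _ fun _ _ h => h.1
    · exact Finset.monotone_filter_right _ fun _ _ h => h.2
  · rw [gridSup, gridSup, Finset.sup_inf_sup]
    refine Finset.sup_le fun x hx => ?_
    simp only [Finset.mem_product, Finset.mem_filter, Finset.mem_univ, true_and] at hx
    rw [← gridInf_inf]
    exact gridInf_le_gridSup g ⟨U.lower inf_le_left hx.1, V.lower inf_le_right hx.2⟩

/-- Membership of `⊥` keeps the value off the new bottom; absence of `⊤` keeps it off the new top.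
-/
theorem exists_bddCoe_eq_gridSup (U : properLowerSets (Grid k)) :
    ∃ y, bddCoe y = gridSup g (U : LowerSet (Grid k)) := by
  classical
  refine exists_bddCoe (fun h => ?_) ?_
  · exact gridInf_ne_bot g ⊥ (le_bot_iff.1 (h ▸ gridInf_le_gridSup g U.2.1))
  · refine Finset.sup_induction (p := fun x => x ≠ ⊤) (fun h => ?_)
      (fun _ h _ h' => sup_ne_top_of_ne_top h h') fun e he => gridInf_ne_top g ?_
    · exact WithBot.bot_ne_coe h
    · rintro rfl
      exact U.2.2 (Finset.mem_filter.1 he).2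

/-- The lattice homomorphism on the proper lower sets of the grid induced by homomorphisms
on the chains. -/
noncomputable def gridDesc : LatticeHom (properLowerSets (Grid k)) Y where
  toFun U := (exists_bddCoe_eq_gridSup g U).choose
  map_sup' U V := bddCoe_injective <| by
    rw [bddCoe_sup, (exists_bddCoe_eq_gridSup g _).choose_spec,
      (exists_bddCoe_eq_gridSup g _).choose_spec, (exists_bddCoe_eq_gridSup g _).choose_spec]
    exact gridSup_sup g _ _
  map_inf' U V := bddCoe_injective <| by
    rw [bddCoe_inf, (exists_bddCoe_eq_gridSup g _).choose_spec,
      (exists_bddCoe_eq_gridSup g _).choose_spec, (exists_bddCoe_eq_gridSup g _).choose_spec]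
    exact gridSup_inf g _ _

theorem bddCoe_gridDesc (U : properLowerSets (Grid k)) :
    bddCoe (gridDesc g U) = gridSup g (U : LowerSet (Grid k)) :=
  (exists_bddCoe_eq_gridSup g U).choose_spec

theorem gridDesc_chainHom (i : ι) (j : Fin (k i)) : gridDesc g (chainHom k i j) = g i j := by
  classical
  apply bddCoe_injective
  rw [bddCoe_gridDesc, ← extendTop_castSucc]
  apply le_antisymm
  · refine Finset.sup_le fun e he => ?_
    refine (Finset.inf_le (Finset.mem_univ i)).trans ?_
    exact extendTop_mono (OrderHomClass.mono (g i)) (Finset.mem_filter.1 he).2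
  -- The largest element of the generator: its other coordinates contribute only `⊤` to the meet.
  · have h : Function.update ⊤ i j.castSucc ∈ (chainHom k i j : LowerSet (Grid k)) := by
      rw [mem_chainHom, Function.update_self]
    refine le_trans (Finset.le_inf fun i' _ => ?_) (gridInf_le_gridSup g h)
    rcases eq_or_ne i' i with rfl | hi
    · rw [Function.update_self]
    · rw [Function.update_of_ne hi, Pi.top_apply, extendTop_last]
      exact le_top

/-- The generators suffice: principal lower sets are finite meets of them, and all others are finite
joins of principal ones. -/
theorem properLowerSets_hom_ext {φ ψ : LatticeHom (properLowerSets (Grid k)) Y}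
    (h : ∀ i j, φ (chainHom k i j) = ψ (chainHom k i j)) : φ = ψ := by
  classical
  have key : ∀ e : Grid k, ∀ he : e ≠ ⊤,
      φ ⟨LowerSet.Iic e, bot_le (a := e), fun h => he (top_le_iff.1 h)⟩ =
        ψ ⟨LowerSet.Iic e, bot_le (a := e), fun h => he (top_le_iff.1 h)⟩ := by
    intro e he
    -- A last coordinate imposes no condition. As `e ≠ ⊤`, the meet over the other coordinates is
    -- non-empty, as preservation by unbounded homomorphisms requires.
    let s : Finset {i // e i ≠ Fin.last _} := Finset.univ
    have hs : s.Nonempty := by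
      obtain ⟨i, hi⟩ := Function.ne_iff.1 he
      exact ⟨⟨i, hi⟩, Finset.mem_univ _⟩
    have heq : (⟨LowerSet.Iic e, bot_le (a := e), fun h => he (top_le_iff.1 h)⟩ :
        properLowerSets (Grid k)) =
        s.inf' hs fun i => chainHom k i.1 ((e i.1).castPred i.2) := by
      apply le_antisymm
      · refine Finset.le_inf' _ _ fun i _ => ?_
        intro e' (he' : e' ≤ e)
        exact (he' i.1).trans (Fin.castSucc_castPred _ i.2).ge
      · intro e' he' i
        by_cases hi : e i = Fin.last _
        · rw [hi]; exact Fin.le_last _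
        · have := (Finset.inf'_le (fun i : {i // e i ≠ Fin.last _} =>
            chainHom k i.1 ((e i.1).castPred i.2)) (Finset.mem_univ ⟨i, hi⟩)) he'
          exact (mem_chainHom k).1 this
    rw [heq, map_finset_inf', map_finset_inf']
    exact Finset.inf'_congr _ rfl fun i _ => h _ _
  ext U
  let s : Finset {e // e ∈ (U : LowerSet (Grid k))} := Finset.univ
  have hs : s.Nonempty := ⟨⟨⊥, U.2.1⟩, Finset.mem_univ _⟩
  have hne : ∀ e : {e // e ∈ (U : LowerSet (Grid k))}, e.1 ≠ ⊤ := fun e he => U.2.2 (he ▸ e.2)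
  have heq : U = s.sup' hs fun e =>
      (⟨LowerSet.Iic e.1, bot_le (a := e.1), fun h => hne e (top_le_iff.1 h)⟩ :
        properLowerSets (Grid k)) := by
    apply le_antisymm
    · intro e he
      have h := Finset.le_sup' (fun e : {e // e ∈ (U : LowerSet (Grid k))} =>
        (⟨LowerSet.Iic e.1, bot_le (a := e.1), fun h => hne e (top_le_iff.1 h)⟩ :
          properLowerSets (Grid k))) (Finset.mem_univ ⟨e, he⟩)
      exact h (le_refl e)
    · refine Finset.sup'_le _ _ fun e _ => ?_
      intro e' (he' : e' ≤ e.1)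
      exact U.1.lower he' e.2
  rw [heq, map_finset_sup', map_finset_sup']
  exact Finset.sup'_congr _ rfl fun e _ => key _ (hne e)

end Coproduct

open CategoryTheory in
/-- Isomorphic distributive lattices are order isomorphic. -/
def distLatOrderIso {X Y : DistLat.{u}} (e : X ≅ Y) : X ≃o Y where
  toFun := e.hom
  invFun := e.inv
  left_inv := DistLat.inv_hom_apply e
  right_inv := DistLat.hom_inv_apply e
  map_rel_iff' {a b} := by
    refine ⟨fun h => ?_, fun h => OrderHomClass.mono e.hom.hom h⟩
    have := OrderHomClass.mono e.inv.hom h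
    rwa [Equiv.coe_fn_mk, DistLat.inv_hom_apply, DistLat.inv_hom_apply] at this

section DistLatCoproduct

variable {ι : Type} (k : ι → ℕ)

/-- The chains with their embeddings into the proper lower sets of the grid. -/
def gridCofan : Cofan fun i => DistLat.of (Fin (k i)) :=
  Cofan.mk (DistLat.of (properLowerSets (Grid k))) fun i => DistLat.ofHom (chainHom k i)

/-- The proper lower sets of the grid are the coproduct of the chains. -/
noncomputable def isColimitGridCofan [Fintype ι] : IsColimit (gridCofan k) :=
  Cofan.IsColimit.mk _ (fun t => DistLat.ofHom (gridDesc fun i => (t.inj i).hom))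
    (fun t i => by
      ext j
      exact gridDesc_chainHom (fun i => (t.inj i).hom) i j)
    fun t m hm => by
      refine DistLat.hom_ext (properLowerSets_hom_ext fun i j => ?_)
      refine Eq.trans ?_ (gridDesc_chainHom (fun i => (t.inj i).hom) i j).symm
      exact DFunLike.congr_fun (congrArg DistLat.Hom.hom (hm i)) j

end DistLatCoproduct

end HomOrder

namespace HomOrder

/-! ### Periodic points and maps commuting with self-maps. -/

section Dynamics

open Function

variable {B C : Type*} {f : B → B} {g : C → C}

theorem iterate_card_mem_periodicPts [Fintype B] (b : B) :
    f^[Fintype.card B] b ∈ periodicPts f := by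
  obtain ⟨i, j, hij, h⟩ := Fintype.exists_ne_map_eq_of_card_lt
    (fun i : Fin (Fintype.card B + 1) => f^[i] b) (by simp)
  wlog hlt : i < j generalizing i j
  · exact this j i hij.symm h.symm (lt_of_le_of_ne (not_lt.1 hlt) hij.symm)
  have hij' : (i : ℕ) < j := hlt
  have hi : f^[i] b ∈ periodicPts f := by
    refine mk_mem_periodicPts (Nat.sub_pos_of_lt hij') ?_
    rw [IsPeriodicPt, IsFixedPt, ← iterate_add_apply, Nat.sub_add_cancel hij'.le]
    exact h.symm
  obtain ⟨d, hd, hp⟩ := mem_periodicPts.1 hi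
  refine mk_mem_periodicPts hd ?_
  have hle : (i : ℕ) ≤ Fintype.card B := Nat.lt_succ_iff.1 i.2
  rw [← Nat.sub_add_cancel hle, iterate_add_apply]
  exact hp.apply_iterate _

theorem iterate_eq_iterate_of_modEq {n i j : ℕ} {b : B} (hb : IsPeriodicPt f n b)
    (h : i ≡ j [MOD n]) : f^[i] b = f^[j] b := by
  rw [← hb.iterate_mod_apply i, ← hb.iterate_mod_apply j, h]

theorem modEq_minimalPeriod_of_iterate_eq {i j : ℕ} {b : B} (hb : b ∈ periodicPts f)
    (h : f^[i] b = f^[j] b) : i ≡ j [MOD minimalPeriod f b] := by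
  wlog hij : i ≤ j generalizing i j
  · exact (this h.symm (le_of_not_ge hij)).symm
  rw [Nat.modEq_iff_dvd' hij, ← minimalPeriod_apply_iterate hb i]
  apply IsPeriodicPt.minimalPeriod_dvd
  rw [IsPeriodicPt, IsFixedPt, ← iterate_add_apply, Nat.sub_add_cancel hij, h]

/-- Points on the same cycle of a map, among the points of period `n`. -/
def orbitSetoid (f : B → B) {n : ℕ} (hn : 0 < n) : Setoid {b // IsPeriodicPt f n b} where
  r x y := ∃ i, f^[i] x.1 = y.1
  iseqv :=
    { refl := fun _ => ⟨0, rfl⟩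
      symm := by
        rintro ⟨x, hx⟩ ⟨y, hy⟩ ⟨i, rfl⟩
        -- Completing `i` steps to `n * i` steps returns to `x`, even when `i > n`.
        refine ⟨n * i - i, ?_⟩
        rw [← iterate_add_apply, Nat.sub_add_cancel (Nat.le_mul_of_pos_left i hn)]
        exact hx.mul_const i
      trans := by
        rintro ⟨x, hx⟩ ⟨y, hy⟩ ⟨z, hz⟩ ⟨i, rfl⟩ ⟨j, rfl⟩
        exact ⟨j + i, iterate_add_apply f j i x⟩ }

/-- On each cycle, choose a representative `r` and a target `c` fixed by the iterate of `g` of order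
the period of `r`, and send `f^[i] r` to `g^[i] c`. The exponent `i` matters only modulo that
period. -/
theorem exists_semiconj_periodic {n : ℕ} (hn : 0 < n)
    (h : ∀ d, d ∣ n → (∃ b, IsPeriodicPt f d b) → ∃ c, IsPeriodicPt g d c) :
    ∃ ψ : {b // IsPeriodicPt f n b} → C, ∀ x, ψ ⟨f x.1, x.2.apply⟩ = g (ψ x) := by
  let s := orbitSetoid f hn
  let rep : {b // IsPeriodicPt f n b} → {b // IsPeriodicPt f n b} := fun x => (⟦x⟧ : Quotient s).out
  have hrep : ∀ x, ∃ i, f^[i] (rep x).1 = x.1 := fun x =>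
    Quotient.exact (Quotient.out_eq (⟦x⟧ : Quotient s))
  have hrep' : ∀ x, rep ⟨f x.1, x.2.apply⟩ = rep x := fun x =>
    congrArg Quotient.out (Quotient.sound (s := s) (Setoid.symm ⟨1, rfl⟩))
  choose i hi using hrep
  have hc : ∀ x : {b // IsPeriodicPt f n b}, ∃ c, IsPeriodicPt g (minimalPeriod f x.1) c := fun x =>
    h _ x.2.minimalPeriod_dvd ⟨x.1, isPeriodicPt_minimalPeriod f x.1⟩
  choose c hc using hc
  refine ⟨fun x => g^[i x] (c (rep x)), fun x => ?_⟩
  dsimp only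
  rw [hrep', ← iterate_succ_apply' g]
  refine iterate_eq_iterate_of_modEq (hc _)
    (modEq_minimalPeriod_of_iterate_eq (mk_mem_periodicPts hn (rep x).2) ?_)
  have h1 := hi ⟨f x.1, x.2.apply⟩
  rw [hrep'] at h1
  rw [h1, iterate_succ_apply', hi]

/-- For existence, push into the periodic part by `f^[m]`, which commutes with `f`, then map cycles.
-/
theorem exists_semiconj_iff {m n : ℕ} (hn : 0 < n) (hf : ∀ b, IsPeriodicPt f n (f^[m] b)) :
    (∃ φ : B → C, Semiconj φ f g) ↔
      ∀ d, d ∣ n → (∃ b, IsPeriodicPt f d b) → ∃ c, IsPeriodicPt g d c := by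
  constructor
  · rintro ⟨φ, hφ⟩ d - ⟨b, hb⟩
    exact ⟨φ b, hb.map hφ⟩
  · intro h
    obtain ⟨ψ, hψ⟩ := exists_semiconj_periodic hn h
    refine ⟨fun b => ψ ⟨f^[m] b, hf b⟩, fun b => ?_⟩
    rw [← hψ]
    refine congrArg ψ (Subtype.ext ?_)
    exact (iterate_succ_apply f m b).symm.trans (iterate_succ_apply' f m b)

end Dynamics

/-! ### Equations of monounary algebras and cycle lengths. -/

section Monounary

open Function

/-- The monounary algebra given by a self-map. -/
@[reducible]
def structureOfMap {B : Type*} (f : B → B) : monounary.Structure B where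
  funMap | .op, x => f (x 0)
  RelMap r := r.elim

theorem funMap_op {B : Type*} [monounary.Structure B] (x : Fin 1 → B) :
    Structure.funMap (L := monounary) MonounaryFunc.op x = op B (x 0) :=
  congrArg _ (funext fun i => by rw [Subsingleton.elim i 0]; rfl)

theorem nonempty_hom_iff {B C : Type*} [monounary.Structure B] [monounary.Structure C] :
    Nonempty (B →[monounary] C) ↔ ∃ φ : B → C, Semiconj φ (op B) (op C) := by
  constructor
  · rintro ⟨φ⟩
    refine ⟨φ, fun b => ?_⟩
    exact (φ.map_fun MonounaryFunc.op ![b]).trans (funMap_op _)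
  · rintro ⟨φ, hφ⟩
    exact ⟨{ toFun := φ
             map_fun' := by
              rintro _ ⟨⟩ x
              exact (congrArg φ (funMap_op x)).trans ((hφ.eq _).trans (funMap_op (φ ∘ x)).symm)
             map_rel' := fun r => r.elim }⟩

theorem exists_realize_eq_iterate (t : monounary.Term ℕ) :
    ∃ i v, ∀ (B : Type u) [monounary.Structure B] (x : ℕ → B), t.realize x = (op B)^[i] (x v) := by
  induction t with
  | var v => exact ⟨0, v, fun _ _ _ => rfl⟩
  | func f ts ih =>
    cases f
    obtain ⟨i, v, h⟩ := ih 0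
    refine ⟨i + 1, v, fun B _ x => ?_⟩
    exact (funMap_op _).trans (by rw [h, iterate_succ_apply'])

theorem exists_term_realize_eq_iterate (i v : ℕ) :
    ∃ t : monounary.Term ℕ, ∀ (B : Type u) [monounary.Structure B] (x : ℕ → B),
      t.realize x = (op B)^[i] (x v) := by
  induction i with
  | zero => exact ⟨Term.var v, fun _ _ _ => rfl⟩
  | succ i ih =>
    obtain ⟨t, h⟩ := ih
    refine ⟨Term.func (L := monounary) MonounaryFunc.op ![t], fun B _ x => ?_⟩
    exact (funMap_op _).trans (by rw [iterate_succ_apply', ← h]; rfl)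

variable {A : Type u} [monounary.Structure A]

/-- Every term is an iterate applied to one variable. -/
theorem memVar_iff {B : Type u} [monounary.Structure B] :
    MemVar monounary A B ↔ ∀ i j v w, (∀ x : ℕ → A, (op A)^[i] (x v) = (op A)^[j] (x w)) →
      ∀ x : ℕ → B, (op B)^[i] (x v) = (op B)^[j] (x w) := by
  constructor
  · intro h i j v w hA x
    obtain ⟨s, hs⟩ := exists_term_realize_eq_iterate.{u} i v
    obtain ⟨t, ht⟩ := exists_term_realize_eq_iterate.{u} j w
    rw [← hs, ← ht]
    exact h s t (fun x => by rw [hs, ht, hA]) x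
  · intro h s t hA x
    obtain ⟨i, v, hs⟩ := exists_realize_eq_iterate.{u} s
    obtain ⟨j, w, ht⟩ := exists_realize_eq_iterate.{u} t
    rw [hs, ht]
    exact h i j v w (fun x => by rw [← hs, ← ht, hA]) x

theorem isCycle_of_mem_periodicPts [DecidableEq A] {a : A} (ha : a ∈ periodicPts (op A)) :
    IsCycle A ((Finset.range (minimalPeriod (op A) a)).image fun i => (op A)^[i] a) := by
  have hpos := minimalPeriod_pos_of_mem_periodicPts ha
  have : NeZero (minimalPeriod (op A) a) := ⟨hpos.ne'⟩
  refine ⟨minimalPeriod (op A) a, this, fun i => (op A)^[i] a, ?_, ?_, fun i => ?_⟩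
  · intro i j hij
    exact Fin.ext (iterate_injOn_Iio_minimalPeriod i.2 j.2 hij)
  · ext b
    simp [Fin.exists_iff]
  · rw [← iterate_succ_apply' (op A)]
    change _ = (op A)^[((i + 1 : Fin _) : ℕ)] a
    rw [Fin.val_add, iterate_mod_minimalPeriod_eq, iterate_add_apply, Fin.val_one',
      iterate_mod_minimalPeriod_eq]
    rfl

theorem IsCycle.exists_minimalPeriod_eq {C : Finset A} (hC : IsCycle A C) :
    ∃ a ∈ periodicPts (op A), minimalPeriod (op A) a = C.card := by
  obtain ⟨m, hm, a, hinj, hrange, hop⟩ := hC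
  have hcard : C.card = m := by
    rw [← Set.ncard_coe_finset, ← hrange, ← Set.image_univ, Set.ncard_image_of_injective _ hinj,
      Set.ncard_univ, Nat.card_fin]
  have hiter : ∀ j : ℕ, (op A)^[j] (a 0) = a (Fin.ofNat m j) := by
    intro j
    induction j with
    | zero => rfl
    | succ j ih =>
      rw [iterate_succ_apply', ih, hop]
      congr 1
      ext
      simp [Fin.val_add]
  have hper : ∀ j, IsPeriodicPt (op A) j (a 0) ↔ m ∣ j := by
    intro j
    rw [IsPeriodicPt, IsFixedPt, hiter, hinj.eq_iff, Nat.dvd_iff_mod_eq_zero, Fin.ext_iff]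
    rfl
  refine ⟨a 0, mk_mem_periodicPts (NeZero.pos m) ((hper m).2 dvd_rfl), ?_⟩
  rw [hcard]
  exact Nat.dvd_antisymm ((hper m).2 dvd_rfl).minimalPeriod_dvd
    ((hper _).1 (isPeriodicPt_minimalPeriod _ _))

variable [Fintype A]

theorem minimalPeriod_dvd_cycleLcm {a : A} (ha : a ∈ periodicPts (op A)) :
    minimalPeriod (op A) a ∣ cycleLcm A := by
  classical
  have hcard : ((Finset.range (minimalPeriod (op A) a)).image fun i => (op A)^[i] a).card =
      minimalPeriod (op A) a := by
    rw [Finset.card_image_of_injOn, Finset.card_range]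
    rw [Finset.coe_range]
    exact iterate_injOn_Iio_minimalPeriod
  rw [← hcard]
  exact Finset.dvd_lcm (Finset.mem_filter.2 ⟨Finset.mem_univ _, isCycle_of_mem_periodicPts ha⟩)

theorem cycleLcm_dvd {d : ℕ} (h : ∀ a ∈ periodicPts (op A), minimalPeriod (op A) a ∣ d) :
    cycleLcm A ∣ d := by
  classical
  refine Finset.lcm_dvd fun C hC => ?_
  obtain ⟨a, ha, hcard⟩ := (Finset.mem_filter.1 hC).2.exists_minimalPeriod_eq
  exact hcard ▸ h a ha

theorem cycleLcm_pos : 0 < cycleLcm A := by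
  refine Nat.pos_of_dvd_of_pos (cycleLcm_dvd fun a ha => ?_) (Nat.factorial_pos (Fintype.card A))
  have hpos := minimalPeriod_pos_of_mem_periodicPts ha
  refine Nat.dvd_factorial hpos ?_
  have h := Fintype.card_le_of_injective (fun i : Fin (minimalPeriod (op A) a) => (op A)^[i] a)
    fun i j hij => Fin.ext (iterate_injOn_Iio_minimalPeriod i.2 j.2 hij)
  rwa [Fintype.card_fin] at h

/-- The equation `f^(n + |A|) x = f^|A| x` holds in `A`, hence in `B`. -/
theorem isPeriodicPt_cycleLcm {B : Type u} [monounary.Structure B] (hB : MemVar monounary A B)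
    (b : B) : IsPeriodicPt (op B) (cycleLcm A) ((op B)^[Fintype.card A] b) := by
  rw [IsPeriodicPt, IsFixedPt, ← iterate_add_apply]
  refine memVar_iff.1 hB (cycleLcm A + Fintype.card A) (Fintype.card A) 0 0 (fun x => ?_) fun _ => b
  rw [iterate_add_apply]
  have h := iterate_card_mem_periodicPts (f := op A) (x 0)
  exact (isPeriodicPt_minimalPeriod (op A) _).trans_dvd (minimalPeriod_dvd_cycleLcm h)

theorem modEq_cycleLcm {i j : ℕ} (h : ∀ a : A, (op A)^[i] a = (op A)^[j] a) :
    i ≡ j [MOD cycleLcm A] := by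
  wlog hij : i ≤ j generalizing i j
  · exact (this (fun a => (h a).symm) (le_of_not_ge hij)).symm
  rw [Nat.modEq_iff_dvd' hij]
  exact cycleLcm_dvd fun a ha =>
    (Nat.modEq_iff_dvd' hij).1 (modEq_minimalPeriod_of_iterate_eq ha (h a))

/-- The hypothesis makes `f^i` constant, so `f^(i+1) = f^i` and `n ∣ 1`. -/
theorem cycleLcm_eq_one_of_iterate_const {i j : ℕ}
    (h : ∀ a b : A, (op A)^[i] a = (op A)^[j] b) : cycleLcm A = 1 := by
  have h' : i + 1 ≡ i [MOD cycleLcm A] := modEq_cycleLcm fun a => by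
    rw [iterate_succ_apply, h _ a, h a a]
  have := (Nat.modEq_iff_dvd' (Nat.le_succ i)).1 h'.symm
  rwa [Nat.succ_eq_add_one, Nat.add_sub_cancel_left, Nat.dvd_one] at this

/-- As `n ≠ 1`, no equation of `A` relates distinct variables; one in a single variable has
exponents congruent modulo `n`. -/
theorem memVar_of_isPeriodicPt (hA : cycleLcm A ≠ 1) {B : Type u} [monounary.Structure B]
    (hB : ∀ b, IsPeriodicPt (op B) (cycleLcm A) b) : MemVar monounary A B := by
  refine memVar_iff.2 fun i j v w h x => ?_
  rcases eq_or_ne v w with rfl | hvw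
  · exact iterate_eq_iterate_of_modEq (hB _) (modEq_cycleLcm fun a => h fun _ => a)
  · refine absurd (cycleLcm_eq_one_of_iterate_const (i := i) (j := j) fun a b => ?_) hA
    have := h (update (fun _ => a) w b)
    rwa [update_self, update_of_ne hvw] at this

end Monounary

/-! ### Divisors as exponent vectors, with order reversed. -/

section ExponentVectors

variable (n : ℕ)

/-- The product of the chains of exponents of the prime powers dividing `n`. -/
abbrev ExponentGrid := Grid fun p : n.primeFactors => n.factorization p

/-- The divisor of `n` obtained by lowering the exponents by those of the given vector. -/
def codivisor (e : ExponentGrid n) : ℕ :=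
  ∏ p : n.primeFactors, (p : ℕ) ^ (n.factorization p - e p)

variable {n}

theorem codivisor_ne_zero (e : ExponentGrid n) : codivisor n e ≠ 0 :=
  Finset.prod_ne_zero_iff.2 fun p _ => pow_ne_zero _ (Nat.prime_of_mem_primeFactors p.2).ne_zero

theorem codivisor_bot (hn : n ≠ 0) : codivisor n ⊥ = n := by
  conv_rhs => rw [← Nat.prod_factorization_pow_eq_self hn]
  rw [Finsupp.prod, Nat.support_factorization, codivisor]
  exact Finset.prod_coe_sort n.primeFactors fun p => p ^ n.factorization p

theorem factorization_codivisor (e : ExponentGrid n) (p : n.primeFactors) :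
    (codivisor n e).factorization p = n.factorization p - e p := by
  rw [codivisor, Nat.factorization_prod fun p _ =>
    pow_ne_zero _ (Nat.prime_of_mem_primeFactors p.2).ne_zero, Finsupp.finsetSum_apply,
    Finset.sum_eq_single p]
  · rw [(Nat.prime_of_mem_primeFactors p.2).factorization_pow, Finsupp.single_eq_same]
  · intro q _ hq
    rw [(Nat.prime_of_mem_primeFactors q.2).factorization_pow, Finsupp.single_eq_of_ne]
    exact fun h => hq (Subtype.ext h.symm)
  · exact fun h => absurd (Finset.mem_univ p) h

theorem codivisor_dvd_codivisor_iff {e e' : ExponentGrid n} :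
    codivisor n e ∣ codivisor n e' ↔ e' ≤ e := by
  constructor
  · intro h p
    have h' := (Nat.factorization_le_iff_dvd (codivisor_ne_zero e) (codivisor_ne_zero e')).2 h p
    rw [factorization_codivisor, factorization_codivisor] at h'
    have h1 : (e p : ℕ) ≤ n.factorization p := (e p).is_le
    have h2 : (e' p : ℕ) ≤ n.factorization p := (e' p).is_le
    exact Fin.le_def.2 (by omega)
  · intro h
    exact Finset.prod_dvd_prod_of_dvd _ _ fun p _ => pow_dvd_pow _ (Nat.sub_le_sub_left (h p) _)

theorem codivisor_dvd (hn : n ≠ 0) (e : ExponentGrid n) : codivisor n e ∣ n := by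
  conv_rhs => rw [← codivisor_bot hn]
  exact codivisor_dvd_codivisor_iff.2 bot_le

theorem exists_codivisor_eq (hn : n ≠ 0) {d : ℕ} (hd : d ∣ n) : ∃ e, codivisor n e = d := by
  have hd0 : d ≠ 0 := ne_zero_of_dvd_ne_zero hn hd
  have hle := (Nat.factorization_le_iff_dvd hd0 hn).2 hd
  let e : ExponentGrid n := fun p =>
    ⟨n.factorization p - d.factorization p, Nat.lt_succ_of_le (Nat.sub_le _ _)⟩
  refine ⟨e, Nat.eq_of_factorization_eq (codivisor_ne_zero e) hd0 fun q => ?_⟩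
  by_cases hq : q ∈ n.primeFactors
  · rw [factorization_codivisor e ⟨q, hq⟩]
    exact Nat.sub_sub_self (hle q)
  · have h0 : n.factorization q = 0 := Finsupp.notMem_support_iff.1 hq
    have h1 := (Nat.factorization_le_iff_dvd (codivisor_ne_zero e) hn).2 (codivisor_dvd hn e) q
    have h2 := hle q
    omega

end ExponentVectors

/-! ### Period sets and the homomorphism lattice. -/

section Iso

open Function

variable (A : Type u) [monounary.Structure A] [Fintype A]

/-- The periods of a member of the variety, as exponent vectors. -/
def periodSet (B : VarFin monounary A) : LowerSet (ExponentGrid (cycleLcm A)) where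
  carrier := {e | ∃ b : B.carrier, IsPeriodicPt (op B.carrier) (codivisor _ e) b}
  lower' := by
    rintro e e' he ⟨b, hb⟩
    exact ⟨b, hb.trans_dvd (codivisor_dvd_codivisor_iff.2 he)⟩

variable {A}

theorem mem_periodSet {B : VarFin monounary A} {e : ExponentGrid (cycleLcm A)} :
    e ∈ periodSet A B ↔ ∃ b : B.carrier, IsPeriodicPt (op B.carrier) (codivisor _ e) b := Iff.rfl

theorem bot_mem_periodSet (B : VarFin monounary A) : ⊥ ∈ periodSet A B := by
  obtain ⟨b⟩ := B.nonempty
  refine mem_periodSet.2 ⟨(op B.carrier)^[Fintype.card A] b, ?_⟩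
  rw [codivisor_bot cycleLcm_pos.ne']
  exact isPeriodicPt_cycleLcm B.mem b

theorem varFin_le_iff {B C : VarFin monounary A} : B ≤ C ↔
    ∀ d, d ∣ cycleLcm A → (∃ b, IsPeriodicPt (op B.carrier) d b) →
      ∃ c, IsPeriodicPt (op C.carrier) d c :=
  nonempty_hom_iff.trans (exists_semiconj_iff cycleLcm_pos (isPeriodicPt_cycleLcm B.mem))

theorem periodSet_le_iff {B C : VarFin monounary A} : periodSet A B ≤ periodSet A C ↔ B ≤ C := by
  rw [varFin_le_iff]
  constructor
  · intro h d hd hB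
    obtain ⟨e, rfl⟩ := exists_codivisor_eq cycleLcm_pos.ne' hd
    exact h hB
  · intro h e he
    exact h _ (codivisor_dvd cycleLcm_pos.ne' e) he

theorem iterate_sigma_zmod {I : Type*} (m : I → ℕ) (j : ℕ) (i : I) (x : ZMod (m i)) :
    (fun y : Σ i, ZMod (m i) => (⟨y.1, y.2 + 1⟩ : Σ i, ZMod (m i)))^[j] ⟨i, x⟩ = ⟨i, x + j⟩ := by
  induction j with
  | zero => simp
  | succ j ih => rw [iterate_succ_apply', ih, Nat.cast_succ, add_assoc]

/-- Take the disjoint union of one cycle of length `codivisor _ e` for each `e ∈ U`; lowerness of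
`U` prevents further periods. -/
theorem exists_periodSet_eq (hA : cycleLcm A ≠ 1) {U : LowerSet (ExponentGrid (cycleLcm A))}
    (hU : ⊥ ∈ U) : ∃ B, periodSet A B = U := by
  let m : {e // e ∈ U} → ℕ := fun e => codivisor _ e.1
  let S := Σ e, ZMod (m e)
  let f : ULift.{u} S → ULift.{u} S := fun y => ⟨⟨y.down.1, y.down.2 + 1⟩⟩
  have : ∀ e, NeZero (m e) := fun e => ⟨codivisor_ne_zero e.1⟩
  have hper : ∀ (j : ℕ) (y : ULift.{u} S), IsPeriodicPt f j y ↔ m y.down.1 ∣ j := by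
    rintro j ⟨⟨e, x⟩⟩
    have hsemi : Semiconj ULift.down f fun y : S => ⟨y.1, y.2 + 1⟩ := fun _ => rfl
    rw [IsPeriodicPt, IsFixedPt, ← ULift.down_injective.eq_iff, (hsemi.iterate_right j).eq,
      iterate_sigma_zmod, ← ZMod.natCast_eq_zero_iff, Sigma.mk.injEq]
    simp
  let _ : monounary.Structure (ULift.{u} S) := structureOfMap f
  let B : VarFin monounary A :=
    { carrier := ULift.{u} S
      nonempty := ⟨⟨⟨⟨⊥, hU⟩, 0⟩⟩⟩
      mem := memVar_of_isPeriodicPt hA fun y =>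
        (hper _ y).2 (codivisor_dvd cycleLcm_pos.ne' _) }
  refine ⟨B, LowerSet.ext (Set.ext fun e => ?_)⟩
  constructor
  · rintro ⟨y, hy⟩
    exact U.lower (codivisor_dvd_codivisor_iff.1 ((hper _ y).1 hy)) y.down.1.2
  · intro he
    exact ⟨⟨⟨⟨e, he⟩, 0⟩⟩, (hper _ _).2 dvd_rfl⟩

/-- A surjective map that preserves and reflects a quasi-order is an isomorphism modulo the
associated equivalence. -/
noncomputable def antisymmetrizationIso {α β : Type*} [Preorder α] [PartialOrder β] (F : α → β)
    (hF : ∀ a b, F a ≤ F b ↔ a ≤ b) (hsurj : Surjective F) :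
    Antisymmetrization α (· ≤ ·) ≃o β :=
  RelIso.ofSurjective
    (OrderEmbedding.ofMapLEIff (fun x => F (ofAntisymmetrization (· ≤ ·) x)) fun a b =>
      (hF _ _).trans ofAntisymmetrization_le_ofAntisymmetrization_iff)
    fun y => by
      obtain ⟨a, rfl⟩ := hsurj y
      refine ⟨toAntisymmetrization _ a, ?_⟩
      have h := Quotient.mk_out (s := AntisymmRel.setoid α (· ≤ ·)) a
      exact le_antisymm ((hF _ _).2 h.1) ((hF _ _).2 h.2)

/-- The homomorphism lattice consists of the non-empty lower sets of exponent vectors. -/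
noncomputable def homLatticeIso (hA : cycleLcm A ≠ 1) : HomLattice monounary A ≃o
    {U : LowerSet (ExponentGrid (cycleLcm A)) // ⊥ ∈ U} :=
  antisymmetrizationIso (fun B => ⟨periodSet A B, bot_mem_periodSet B⟩)
    (fun _ _ => periodSet_le_iff) fun U => by
      obtain ⟨B, hB⟩ := exists_periodSet_eq hA U.2
      exact ⟨B, Subtype.ext hB⟩

/-- The non-empty lower sets are the proper ones with a new top. -/
noncomputable def properLowerSetsSumIso (α : Type*) [Lattice α] [BoundedOrder α] :
    (properLowerSets α ⊕ₗ Fin 1) ≃o {U : LowerSet α // ⊥ ∈ U} :=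
  RelIso.ofSurjective
    (OrderEmbedding.ofMapLEIff (α := properLowerSets α ⊕ₗ Fin 1) (β := {U : LowerSet α // ⊥ ∈ U})
      (fun x => Sum.elim (fun U => ⟨U.1, U.2.1⟩) (fun _ => ⟨⊤, trivial⟩) (ofLex x)) (by
        rintro (U | i) (V | j)
        · exact (Sum.Lex.inl_le_inl_iff (a := U) (b := V)).symm
        · exact iff_of_true (show (_ : LowerSet α) ≤ ⊤ from le_top) (Sum.Lex.inl_le_inr U j)
        · exact iff_of_false (fun h => V.2.2 (h (show ⊤ ∈ (⊤ : LowerSet α) from trivial)))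
            Sum.Lex.not_inr_le_inl
        · exact iff_of_true le_rfl (Sum.Lex.inr_le_inr_iff.2 (Subsingleton.elim i j).le)))
    fun U => by
      by_cases h : ⊤ ∈ U.1
      · exact ⟨toLex (Sum.inr 0), Subtype.ext (LowerSet.ext (Set.ext fun x =>
          iff_of_true trivial (U.1.lower le_top h)))⟩
      · exact ⟨toLex (Sum.inl ⟨U.1, U.2, h⟩), rfl⟩

/-- Every member has a fixed point, which receives a homomorphism from any algebra. -/
theorem homLattice_subsingleton (hA : cycleLcm A = 1) :
    Subsingleton (HomLattice monounary A) := by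
  have key : ∀ B C : VarFin monounary A, B ≤ C := fun B C => by
    refine varFin_le_iff.2 fun d _ _ => ?_
    obtain ⟨c⟩ := C.nonempty
    have h := isPeriodicPt_cycleLcm C.mem c
    rw [hA] at h
    exact ⟨_, h.trans_dvd (one_dvd d)⟩
  refine ⟨fun x y => ?_⟩
  induction x using Antisymmetrization.induction_on
  induction y using Antisymmetrization.induction_on
  exact Quotient.sound ⟨key _ _, key _ _⟩

end Iso

end HomOrder

theorem mainTheorem9 (A : Type u) [HomOrder.monounary.Structure A] [Fintype A] [Nonempty A] :
    (HomOrder.cycleLcm A = 1 →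
      Nonempty (HomOrder.HomLattice HomOrder.monounary A ≃o Fin 1)) ∧
    (HomOrder.cycleLcm A ≠ 1 →
      ∃ _ : HasCoproduct (HomOrder.chains (HomOrder.cycleLcm A)),
        Nonempty (HomOrder.HomLattice HomOrder.monounary A ≃o
          ((∐ HomOrder.chains (HomOrder.cycleLcm A) : DistLat.{0}) ⊕ₗ Fin 1))) := by
  constructor
  · intro hA
    have := HomOrder.homLattice_subsingleton hA
    let x : HomOrder.HomLattice HomOrder.monounary A :=
      toAntisymmetrization _ { carrier := A, mem := fun _ _ h => h }
    have : Unique (HomOrder.HomLattice HomOrder.monounary A) :=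
      ⟨⟨x⟩, fun _ => Subsingleton.elim _ _⟩
    exact ⟨OrderIso.ofUnique _ _⟩
  · intro hA
    have hc : IsColimit (HomOrder.gridCofan _ : Cofan (HomOrder.chains (HomOrder.cycleLcm A))) :=
      HomOrder.isColimitGridCofan _
    have : HasCoproduct (HomOrder.chains (HomOrder.cycleLcm A)) := ⟨⟨⟨_, hc⟩⟩⟩
    exact ⟨this, ⟨(HomOrder.homLatticeIso hA).trans <|
      (HomOrder.properLowerSetsSumIso _).symm.trans <|
      OrderIso.sumLexCongr (HomOrder.distLatOrderIso (hc.coconePointUniqueUpToIso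
        (coproductIsCoproduct (HomOrder.chains (HomOrder.cycleLcm A))))) (OrderIso.refl _)⟩⟩
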